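/- Let $(X,|\cdot\,\cdot|)$ be a complete metric space whose metric is intrinsic, i.e. for all $x,y\in X$ the distance $|xy|$ is the infimum of the lengths of the continuous curves joining $x$ to $y$. For $p\in X$ and $x,y\in X\setminus\{p\}$ let the model angle $\tilde\angle(p;x,y)\in[0,\pi]$ be the angle at $\tilde p$ of a triangle $\tilde p\tilde x\tilde y$ in the Euclidean plane with $|\tilde p\tilde x|=|px|$, $|\tilde p\tilde y|=|py|$, $|\tilde x\tilde y|=|xy|$. The space $X$ is called an Alexandrov space with curvature $\ge 0$ if, in addition to being complete with intrinsic metric, it satisfies $$\tilde\angle(p;x,y)+\tilde\angle(p;y,z)+\tilde\angle(p;z,x)\le 2\pi$$ for all $p\in X$ and $x,y,z\in X\setminus\{p\}$. Then $X$ is an Alexandrov space with curvature $\ge 0$ if and only if every quadruple of points $p,x,y,z\in X$ satisfies $$|px|^2+|py|^2+|pz|^2\ \ge\ \tfrac13\left(|xy|^2+|yz|^2+|zx|^2\right).$$ -/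

import Mathlib

/-- The metric of `X` is intrinsic: the distance between any two points is the infimum of the
lengths of the continuous curves joining them. The length of a curve is the supremum of
`∑ dist (γ tᵢ) (γ tᵢ₊₁)` over finite partitions, i.e. its total variation. As `edist` is finite,
the infimum is over a nonempty set and some curve has finite length. -/
def IsIntrinsicMetric (X : Type*) [MetricSpace X] : Prop :=
  ∀ x y : X, edist x y = ⨅ γ : Path x y, eVariationOn γ Set.univ

/-- The model angle at `p` of the triple `p, x, y`: for `x ≠ p ≠ y`, the angle at `p̃` of a triangle
`p̃ x̃ ỹ` in the Euclidean plane with the same side lengths (law of cosines). -/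
noncomputable def modelAngle {X : Type*} [MetricSpace X] (p x y : X) : ℝ :=
  Real.arccos ((dist p x ^ 2 + dist p y ^ 2 - dist x y ^ 2) / (2 * dist p x * dist p y))

/-- Alexandrov spaces with curvature `≥ 0`: complete spaces with intrinsic metric in which, for
every quadruple of points whose model angles at `p` are defined, these add up to at most `2π`. -/
structure IsAlexandrovNonneg (X : Type*) [MetricSpace X] : Prop where
  complete : CompleteSpace X
  intrinsic : IsIntrinsicMetric X
  comparison : ∀ p x y z : X, x ≠ p → y ≠ p → z ≠ p →
    modelAngle p x y + modelAngle p y z + modelAngle p z x ≤ 2 * Real.pi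

/-!
Write `⟨x, y⟩ = (|px|² + |py|² - |xy|²) / 2` and let
`Q(r, s, t) = r²|px|² + s²|py|² + t²|pz|² + 2 (rs ⟨x, y⟩ + st ⟨y, z⟩ + tr ⟨z, x⟩)`. The inequality
of the theorem says `Q(1, 1, 1) ≥ 0`, while the model angles at `p` add up to at most `2π` exactly
when `Q ≥ 0` for all nonnegative weights; the angle comparison thus contains the inequality.

Conversely, applying the inequality to points that approach an approximate midpoint `z` of `x` and
`y` geometrically gives, in the limit, the median comparison
`|vx|² + |vy|² ≤ 2|vz|² + |xy|² / 2`. Repeated bisection turns it into the comparison for points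
dividing a side in any ratio, which yields, for `r ∈ [0, 1]`, a point `w` with `|pw| ≈ r|px|` and
`⟨w, y⟩ ≲ r ⟨x, y⟩`. Replacing each of `x, y, z` by such a point, `Q(1, 1, 1) ≥ 0` becomes
`Q(r, s, t) ≥ 0`.
-/

open Filter Topology

section RightLimits

variable {α : Type*} [TopologicalSpace α] {f : ℝ → α} {a : α}

theorem le_apply_zero_of_forall_pos_le [Preorder α] [ClosedIciTopology α]
    (hf : ContinuousWithinAt f (Set.Ioi 0) 0) (h : ∀ ε > 0, a ≤ f ε) : a ≤ f 0 :=
  ge_of_tendsto hf (eventually_mem_nhdsWithin.mono h)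

theorem exists_pos_lt_and_apply_lt [LinearOrder α] [ClosedIciTopology α]
    (hf : ContinuousWithinAt f (Set.Ioi 0) 0) (ha : f 0 < a) {ε : ℝ} (hε : 0 < ε) :
    ∃ η > 0, η < ε ∧ f η < a := by
  have hIoo : ∀ᶠ η in 𝓝[>] (0 : ℝ), η ∈ Set.Ioo 0 ε := Ioo_mem_nhdsGT hε
  obtain ⟨η, hη, hfη⟩ := (hIoo.and (hf.eventually_lt_const ha)).exists
  exact ⟨η, hη.1, hη.2, hfη⟩

end RightLimits

section IntermediatePoints

/-- Every pair of points has approximate intermediate points dividing the distance in any given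
ratio. In this form, intrinsicness of the metric enters the comparison argument without mentioning
curves; unlike it, the property passes to dense subsets. -/
def HasApproxIntermediatePoints (X : Type*) [PseudoMetricSpace X] : Prop :=
  ∀ (x y : X), ∀ t ∈ Set.Icc (0 : ℝ) 1, ∀ ε > 0, ∃ q : X,
    dist x q ≤ t * dist x y + ε ∧ dist q y ≤ (1 - t) * dist x y + ε

theorem edist_add_edist_le_eVariationOn_path {X : Type*} [PseudoEMetricSpace X] {x y : X}
    (γ : Path x y) (s : unitInterval) :
    edist x (γ s) + edist (γ s) y ≤ eVariationOn γ Set.univ :=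
  calc edist x (γ s) + edist (γ s) y
      = edist (γ 0) (γ s) + edist (γ s) (γ 1) := by rw [γ.source, γ.target]
    _ ≤ eVariationOn γ (Set.Iic s) + eVariationOn γ (Set.Ici s) :=
        add_le_add (eVariationOn.edist_le _ s.2.1 Set.self_mem_Iic)
          (eVariationOn.edist_le _ Set.self_mem_Ici s.2.2)
    _ ≤ eVariationOn γ (Set.Iic s ∪ Set.Ici s) :=
        eVariationOn.add_le_union _ fun _ ha _ hb => le_trans ha hb
    _ ≤ eVariationOn γ Set.univ := eVariationOn.mono _ (Set.subset_univ _)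

theorem exists_dist_path_eq_mul {X : Type*} [PseudoMetricSpace X] {x y : X} (γ : Path x y) {t : ℝ}
    (ht : t ∈ Set.Icc (0 : ℝ) 1) : ∃ s, dist x (γ s) = t * dist x y := by
  have hcont : Continuous fun s => dist x (γ s) := by fun_prop
  refine mem_range_of_exists_le_of_exists_ge hcont ⟨0, ?_⟩ ⟨1, ?_⟩
  · simpa using mul_nonneg ht.1 dist_nonneg
  · simpa using mul_le_of_le_one_left dist_nonneg ht.2

theorem IsIntrinsicMetric.hasApproxIntermediatePoints {X : Type*} [MetricSpace X]
    (hX : IsIntrinsicMetric X) : HasApproxIntermediatePoints X := by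
  intro x y t ht ε hε
  have hlt : ⨅ γ : Path x y, eVariationOn γ Set.univ < ENNReal.ofReal (dist x y + ε) := by
    rw [← hX x y, edist_dist]
    exact (ENNReal.ofReal_lt_ofReal_iff (by positivity)).2 (by linarith)
  obtain ⟨γ, hγ⟩ := iInf_lt_iff.1 hlt
  obtain ⟨s, hs⟩ := exists_dist_path_eq_mul γ ht
  have hle := (edist_add_edist_le_eVariationOn_path γ s).trans hγ.le
  rw [edist_dist, edist_dist, ← ENNReal.ofReal_add dist_nonneg dist_nonneg,
    ENNReal.ofReal_le_ofReal_iff (by positivity)] at hle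
  exact ⟨γ s, by linarith, by linarith⟩

end IntermediatePoints

section Comparison

variable {X : Type*} [PseudoMetricSpace X]

/-- The squared distances from any point to the vertices of a triangle add up to at least a third
of the sum of the squared side lengths, with equality in Euclidean space when the point is the
barycenter. -/
def BarycentricInequality (X : Type*) [PseudoMetricSpace X] : Prop :=
  ∀ p x y z : X, dist p x ^ 2 + dist p y ^ 2 + dist p z ^ 2 ≥
    (1 / 3) * (dist x y ^ 2 + dist y z ^ 2 + dist z x ^ 2)

/-- The excess `(1 / 3) ^ n` over the Euclidean coefficient `2` shrinks by a factor `3` when `v` is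
replaced by the point dividing `zv` in the ratio `1 : 2`. -/
theorem BarycentricInequality.add_sq_dist_le (h : BarycentricInequality X)
    (hX : HasApproxIntermediatePoints X) (n : ℕ) (x y z v : X) :
    dist v x ^ 2 + dist v y ^ 2 ≤ (2 + (1 / 3) ^ n) * dist v z ^ 2 + dist x y ^ 2 / 2 +
      3 ^ (n + 1) * (dist z x ^ 2 + dist z y ^ 2 - dist x y ^ 2 / 2) := by
  induction n generalizing v with
  | zero =>
    have := h z v x y
    rw [dist_comm z v, dist_comm y v] at this
    norm_num
    linarith
  | succ n ih =>
    let bound (ε : ℝ) : ℝ :=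
      3 * ((2 + (1 / 3) ^ n) * (1 / 3 * dist z v + ε) ^ 2 + dist x y ^ 2 / 2 +
        3 ^ (n + 1) * (dist z x ^ 2 + dist z y ^ 2 - dist x y ^ 2 / 2)) +
      3 * ((1 - 1 / 3) * dist z v + ε) ^ 2 - dist x y ^ 2
    have hbound : ∀ ε > 0, dist v x ^ 2 + dist v y ^ 2 ≤ bound ε := by
      intro ε hε
      obtain ⟨q, hzq, hqv⟩ := hX z v (1 / 3) ⟨by norm_num, by norm_num⟩ ε hε
      have hbary := h q x y v
      have hzq_sq : (2 + (1 / 3) ^ n) * dist q z ^ 2 ≤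
          (2 + (1 / 3) ^ n) * (1 / 3 * dist z v + ε) ^ 2 := by
        rw [dist_comm q z]
        gcongr
      have hqv_sq : dist q v ^ 2 ≤ ((1 - 1 / 3) * dist z v + ε) ^ 2 := by gcongr
      rw [dist_comm y v] at hbary
      simp only [bound]
      linarith [ih q]
    refine (le_apply_zero_of_forall_pos_le (by fun_prop) hbound).trans_eq ?_
    simp only [bound, dist_comm z v]
    ring

theorem BarycentricInequality.exists_median_le (h : BarycentricInequality X)
    (hX : HasApproxIntermediatePoints X) (R : ℝ) {ε : ℝ} (hε : 0 < ε) :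
    ∃ δ > 0, ∀ x y z v : X, dist v z ≤ R → dist z x ^ 2 + dist z y ^ 2 ≤ dist x y ^ 2 / 2 + δ →
      dist v x ^ 2 + dist v y ^ 2 ≤ 2 * dist v z ^ 2 + dist x y ^ 2 / 2 + ε := by
  obtain ⟨n, hn⟩ := exists_pow_lt_of_lt_one (y := (1 / 3 : ℝ))
    (show 0 < ε / 2 / (R ^ 2 + 1) by positivity) (by norm_num)
  rw [lt_div_iff₀ (by positivity)] at hn
  refine ⟨ε / 2 / 3 ^ (n + 1), by positivity, fun x y z v hv hz => ?_⟩
  have hdefect : 3 ^ (n + 1) * (dist z x ^ 2 + dist z y ^ 2 - dist x y ^ 2 / 2) ≤ ε / 2 := by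
    rw [← le_div_iff₀' (by positivity)]
    linarith
  have hexcess : (1 / 3) ^ n * dist v z ^ 2 ≤ (1 / 3) ^ n * (R ^ 2 + 1) := by
    gcongr
    linarith [pow_le_pow_left₀ dist_nonneg hv 2]
  linarith [h.add_sq_dist_le hX n x y z v]

theorem BarycentricInequality.exists_approx_midpoint (h : BarycentricInequality X)
    (hX : HasApproxIntermediatePoints X) {S : Set X} (hS : Bornology.IsBounded S) (x y : X)
    {ε : ℝ} (hε : 0 < ε) :
    ∃ z, dist x z ≤ dist x y / 2 + ε ∧ dist z y ≤ dist x y / 2 + ε ∧ ∀ v ∈ S,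
      dist v x ^ 2 + dist v y ^ 2 ≤ 2 * dist v z ^ 2 + dist x y ^ 2 / 2 + ε := by
  obtain ⟨R, hR⟩ := hS.subset_closedBall x
  obtain ⟨δ, hδ, hmedian⟩ := h.exists_median_le hX (R + (dist x y / 2 + ε)) hε
  obtain ⟨η, hη, hηε, hsmall⟩ := exists_pos_lt_and_apply_lt (a := dist x y ^ 2 / 2 + δ)
    (f := fun η => 2 * (dist x y / 2 + η) ^ 2) (by fun_prop) (by linarith) hε
  obtain ⟨z, hxz, hzy⟩ := hX x y (1 / 2) ⟨by norm_num, by norm_num⟩ η hη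
  have hxz_sq : dist x z ^ 2 ≤ (dist x y / 2 + η) ^ 2 := by
    gcongr
    linarith
  have hzy_sq : dist z y ^ 2 ≤ (dist x y / 2 + η) ^ 2 := by
    gcongr
    linarith
  refine ⟨z, by linarith, by linarith, fun v hv => hmedian x y z v ?_ ?_⟩
  · linarith [dist_triangle v x z, Metric.mem_closedBall.1 (hR hv)]
  · rw [dist_comm z x]
    linarith

/-- Approximate point-on-side comparison: there are almost `t`-intermediate points of `p` and `x`
whose squared distance to every point of `S` is at least the one in the Euclidean model triangle
(Stewart's theorem), up to the error `e`. -/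
def SideComparison (S : Set X) (p x : X) (t e : ℝ) : Prop :=
  ∀ δ > 0, ∃ w : X, dist p w ≤ t * dist p x + δ ∧ dist w x ≤ (1 - t) * dist p x + δ ∧
    ∀ y ∈ S, (1 - t) * dist p y ^ 2 + t * dist x y ^ 2 ≤
      dist w y ^ 2 + t * (1 - t) * dist p x ^ 2 + e + δ

theorem SideComparison.symm {S : Set X} {p x : X} {t e : ℝ} (h : SideComparison S p x t e) :
    SideComparison S x p (1 - t) e := by
  intro δ hδ
  obtain ⟨w, hpw, hwx, hw⟩ := h δ hδ
  rw [dist_comm p w] at hpw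
  rw [dist_comm w x] at hwx
  simp only [dist_comm x p, sub_sub_cancel]
  exact ⟨w, hwx, hpw, fun y hy => by linarith [hw y hy]⟩

theorem BarycentricInequality.sideComparison_half (h : BarycentricInequality X)
    (hX : HasApproxIntermediatePoints X) {S : Set X} (hS : Bornology.IsBounded S) {p x : X}
    {t e : ℝ} (hs : SideComparison S p x t e) : SideComparison S p x (t / 2) (e / 2) := by
  intro δ hδ
  obtain ⟨η, hη, hηδ, hsmall⟩ := exists_pos_lt_and_apply_lt
    (a := (t * dist p x) ^ 2 + δ) (f := fun η => (t * dist p x + η) ^ 2) (by fun_prop)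
    (by simpa using hδ) (show 0 < δ / 3 by positivity)
  obtain ⟨w, hpw, hwx, hw⟩ := hs η hη
  obtain ⟨z, hpz, hzw, hz⟩ := h.exists_approx_midpoint hX hS p w hη
  refine ⟨z, by linarith, by linarith [dist_triangle z w x], fun y hy => ?_⟩
  have hpw_sq : dist p w ^ 2 ≤ (t * dist p x + η) ^ 2 := by gcongr
  have hmedian := hz y hy
  rw [dist_comm y p, dist_comm y w, dist_comm y z] at hmedian
  linarith [hw y hy]

theorem HasApproxIntermediatePoints.exists_sideComparison (hX : HasApproxIntermediatePoints X)
    {S : Set X} (hS : Bornology.IsBounded S) (p x : X) :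
    ∃ C, ∀ t ∈ Set.Icc (0 : ℝ) 1, SideComparison S p x t C := by
  obtain ⟨R, hR⟩ := hS.subset_closedBall p
  obtain ⟨R', hR'⟩ := hS.subset_closedBall x
  refine ⟨R ^ 2 + R' ^ 2, fun t ht δ hδ => ?_⟩
  obtain ⟨w, hpw, hwx⟩ := hX p x t ht δ hδ
  refine ⟨w, hpw, hwx, fun y hy => ?_⟩
  have ht' : 0 ≤ 1 - t := sub_nonneg.2 ht.2
  have hpy : (1 - t) * dist p y ^ 2 ≤ 1 * R ^ 2 := by
    gcongr
    · linarith [ht.1]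
    · exact Metric.mem_closedBall'.1 (hR hy)
  have hxy : t * dist x y ^ 2 ≤ 1 * R' ^ 2 := by
    gcongr
    · exact ht.2
    · exact Metric.mem_closedBall'.1 (hR' hy)
  have hside : 0 ≤ t * (1 - t) * dist p x ^ 2 :=
    mul_nonneg (mul_nonneg ht.1 ht') (sq_nonneg _)
  linarith [sq_nonneg (dist w y)]

/-- A `t`-point of a side with `t ≤ 1 / 2` is the midpoint of an endpoint and a `2t`-point. -/
theorem BarycentricInequality.sideComparison_forall_half (h : BarycentricInequality X)
    (hX : HasApproxIntermediatePoints X) {S : Set X} (hS : Bornology.IsBounded S) {p x : X}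
    {e : ℝ} (hall : ∀ t ∈ Set.Icc (0 : ℝ) 1, SideComparison S p x t e) :
    ∀ t ∈ Set.Icc (0 : ℝ) 1, SideComparison S p x t (e / 2) := by
  intro t ht
  rcases le_total t (1 / 2) with hle | hle
  · have := h.sideComparison_half hX hS (hall (2 * t) ⟨by linarith [ht.1], by linarith⟩)
    rwa [mul_div_cancel_left₀ t two_ne_zero] at this
  · have hdouble : 1 - 2 * (1 - t) ∈ Set.Icc (0 : ℝ) 1 := ⟨by linarith, by linarith [ht.2]⟩
    have := (h.sideComparison_half hX hS (hall _ hdouble).symm).symm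
    rwa [sub_sub_cancel, mul_div_cancel_left₀ _ two_ne_zero, sub_sub_cancel] at this

theorem BarycentricInequality.sideComparison_zero (h : BarycentricInequality X)
    (hX : HasApproxIntermediatePoints X) {S : Set X} (hS : Bornology.IsBounded S) (p x : X)
    {t : ℝ} (ht : t ∈ Set.Icc (0 : ℝ) 1) : SideComparison S p x t 0 := by
  obtain ⟨C, hC⟩ := hX.exists_sideComparison hS p x
  have hiterate : ∀ n : ℕ, ∀ t ∈ Set.Icc (0 : ℝ) 1, SideComparison S p x t (C / 2 ^ n) := by
    intro n
    induction n with
    | zero => simpa using hC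
    | succ n ih =>
      rw [pow_succ, ← div_div]
      exact h.sideComparison_forall_half hX hS ih
  have hlim : Tendsto (fun n : ℕ => C / 2 ^ n) atTop (𝓝 0) :=
    tendsto_const_nhds.div_atTop (tendsto_pow_atTop_atTop_of_one_lt one_lt_two)
  intro δ hδ
  obtain ⟨n, hn⟩ := (hlim.eventually_lt_const (half_pos hδ)).exists
  obtain ⟨w, hpw, hwx, hw⟩ := hiterate n t ht (δ / 2) (half_pos hδ)
  exact ⟨w, by linarith, by linarith, fun y hy => by linarith [hw y hy]⟩

end Comparison

section GramForm

/-- The scalar product of the vectors `x̃ - p̃` and `ỹ - p̃` in the Euclidean model triangle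
`p̃ x̃ ỹ`, by polarization. -/
noncomputable def modelInner {X : Type*} [PseudoMetricSpace X] (p x y : X) : ℝ :=
  (dist p x ^ 2 + dist p y ^ 2 - dist x y ^ 2) / 2

/-- The quadratic form whose matrix is the Gram matrix of model scalar products at `p` of the points
`x, y, z`. If the four points embed isometrically into a Euclidean space, it is the squared norm
of `r (x - p) + s (y - p) + t (z - p)`. -/
noncomputable def gramForm {X : Type*} [PseudoMetricSpace X] (p x y z : X) (r s t : ℝ) : ℝ :=
  r ^ 2 * dist p x ^ 2 + s ^ 2 * dist p y ^ 2 + t ^ 2 * dist p z ^ 2 +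
    2 * (r * s * modelInner p x y + s * t * modelInner p y z + t * r * modelInner p z x)

variable {X : Type*} [PseudoMetricSpace X]

theorem modelInner_comm (p x y : X) : modelInner p x y = modelInner p y x := by
  rw [modelInner, modelInner, dist_comm x y, add_comm (dist p x ^ 2)]

theorem gramForm_rotate (p x y z : X) (r s t : ℝ) :
    gramForm p x y z r s t = gramForm p y z x s t r := by
  simp only [gramForm]
  ring

theorem gramForm_mul (p x y z : X) (k r s t : ℝ) :
    gramForm p x y z (k * r) (k * s) (k * t) = k ^ 2 * gramForm p x y z r s t := by
  simp only [gramForm]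
  ring

theorem barycentricInequality_iff_gramForm_one_nonneg :
    BarycentricInequality X ↔ ∀ p x y z : X, 0 ≤ gramForm p x y z 1 1 1 := by
  refine forall₄_congr fun p x y z => ?_
  simp only [gramForm, modelInner]
  constructor <;> intro <;> linarith

theorem BarycentricInequality.exists_modelInner_le (h : BarycentricInequality X)
    (hX : HasApproxIntermediatePoints X) {S : Set X} (hS : Bornology.IsBounded S) (p x : X)
    {t : ℝ} (ht : t ∈ Set.Icc (0 : ℝ) 1) {ε : ℝ} (hε : 0 < ε) :
    ∃ w, dist p w ^ 2 ≤ t ^ 2 * dist p x ^ 2 + ε ∧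
      ∀ y ∈ S, modelInner p w y ≤ t * modelInner p x y + ε := by
  obtain ⟨η, hη, hηε, hsmall⟩ := exists_pos_lt_and_apply_lt
    (a := (t * dist p x) ^ 2 + ε) (f := fun η => (t * dist p x + η) ^ 2) (by fun_prop)
    (by simpa using hε) hε
  obtain ⟨w, hpw, -, hw⟩ := h.sideComparison_zero hX hS p x ht η hη
  have hpw_sq : dist p w ^ 2 ≤ (t * dist p x + η) ^ 2 := by gcongr
  refine ⟨w, by linarith, fun y hy => ?_⟩
  simp only [modelInner]
  linarith [hw y hy]

theorem BarycentricInequality.gramForm_nonneg_of_forall_one (h : BarycentricInequality X)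
    (hX : HasApproxIntermediatePoints X) {p y z : X} {r s t : ℝ} (hr : r ∈ Set.Icc (0 : ℝ) 1)
    (hs : 0 ≤ s) (ht : 0 ≤ t) (hone : ∀ x, 0 ≤ gramForm p x y z 1 s t) (x : X) :
    0 ≤ gramForm p x y z r s t := by
  let bound (ε : ℝ) : ℝ := gramForm p x y z r s t + (1 + 2 * s + 2 * t) * ε
  have hbound : ∀ ε > 0, 0 ≤ bound ε := by
    intro ε hε
    obtain ⟨w, hpw, hw⟩ := h.exists_modelInner_le hX (Set.toFinite {y, z}).isBounded p x hr hε
    have hwy := mul_le_mul_of_nonneg_left (hw y (by simp)) hs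
    have hwz := mul_le_mul_of_nonneg_left (hw z (by simp)) ht
    have hw_nonneg := hone w
    simp only [bound, gramForm, modelInner_comm p z] at hw_nonneg ⊢
    linarith
  refine (le_apply_zero_of_forall_pos_le (by fun_prop) hbound).trans_eq ?_
  simp only [bound, mul_zero, add_zero]

theorem BarycentricInequality.gramForm_nonneg (h : BarycentricInequality X)
    (hX : HasApproxIntermediatePoints X) (p x y z : X) {r s t : ℝ} (hr : 0 ≤ r) (hs : 0 ≤ s)
    (ht : 0 ≤ t) : 0 ≤ gramForm p x y z r s t := by
  have hone := barycentricInequality_iff_gramForm_one_nonneg.1 h p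
  have of_mem_Icc {r s t : ℝ} (hr : r ∈ Set.Icc (0 : ℝ) 1) (hs : s ∈ Set.Icc (0 : ℝ) 1)
      (ht : t ∈ Set.Icc (0 : ℝ) 1) : 0 ≤ gramForm p x y z r s t := by
    refine h.gramForm_nonneg_of_forall_one hX hr hs.1 ht.1 (fun x => ?_) x
    rw [gramForm_rotate]
    refine h.gramForm_nonneg_of_forall_one hX hs ht.1 zero_le_one (fun y => ?_) y
    rw [gramForm_rotate]
    exact h.gramForm_nonneg_of_forall_one hX ht zero_le_one zero_le_one (fun z => hone z x y) z
  set N := r + s + t + 1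
  have hN : 0 < N := by positivity
  have mem_Icc {u : ℝ} (hu : 0 ≤ u) (huN : u ≤ N) : N⁻¹ * u ∈ Set.Icc (0 : ℝ) 1 :=
    ⟨by positivity, inv_mul_le_one_of_le₀ huN hN.le⟩
  have hscaled := of_mem_Icc (mem_Icc hr (by linarith)) (mem_Icc hs (by linarith))
    (mem_Icc ht (by linarith))
  rw [gramForm_mul] at hscaled
  exact nonneg_of_mul_nonneg_right hscaled (by positivity)

end GramForm

section CosForm

open Real

/-- The quadratic form of the symmetric matrix with unit diagonal and off-diagonal entries the
cosines of `α, β, γ`, at the indices `12`, `23`, `31`. -/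
noncomputable def cosForm (α β γ a b c : ℝ) : ℝ :=
  a ^ 2 + b ^ 2 + c ^ 2 + 2 * (a * b * cos α + b * c * cos β + c * a * cos γ)

theorem cosForm_rotate (α β γ a b c : ℝ) : cosForm α β γ a b c = cosForm β γ α b c a := by
  simp only [cosForm]
  ring

theorem cosForm_add_eq_sq_add_sq (α β a b c : ℝ) :
    cosForm α β (α + β) a b c =
      (a * cos α + b + c * cos β) ^ 2 + (a * sin α - c * sin β) ^ 2 := by
  rw [cosForm, cos_add]
  linear_combination -a ^ 2 * sin_sq α - c ^ 2 * sin_sq β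

variable {α β γ : ℝ}

theorem add_le_pi_iff_cos_add_cos_nonneg (hα : α ∈ Set.Icc 0 π) (hβ : β ∈ Set.Icc 0 π) :
    α + β ≤ π ↔ 0 ≤ cos α + cos β := by
  have hβ' : π - β ∈ Set.Icc 0 π := ⟨sub_nonneg.2 hβ.2, sub_le_self π hβ.1⟩
  rw [← le_sub_iff_add_le, ← strictAntiOn_cos.le_iff_ge hβ' hα, cos_pi_sub, neg_le_iff_add_nonneg]

theorem cosForm_nonneg_of_add_le_two_pi (hα : α ∈ Set.Icc 0 π) (hβ : β ∈ Set.Icc 0 π)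
    (hγ : γ ∈ Set.Icc 0 π) (h : α + β + γ ≤ 2 * π) {a b c : ℝ} (ha : 0 ≤ a) (hb : 0 ≤ b)
    (hc : 0 ≤ c) : 0 ≤ cosForm α β γ a b c := by
  rcases le_total π (α + β) with hle | hle
  · have hcos : cos (α + β) ≤ cos γ := by
      rw [← cos_two_pi_sub]
      exact cos_le_cos_of_nonneg_of_le_pi hγ.1 (by linarith) (by linarith)
    calc 0 ≤ cosForm α β (α + β) a b c := by
          rw [cosForm_add_eq_sq_add_sq]
          positivity
      _ ≤ cosForm α β γ a b c := by
          simp only [cosForm]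
          gcongr
  · have hαβ : -cos β ≤ cos α := by
      linarith [(add_le_pi_iff_cos_add_cos_nonneg hα hβ).1 hle]
    calc 0 ≤ (a - c - b * cos β) ^ 2 + (b * sin β) ^ 2 := by positivity
      _ = a ^ 2 + b ^ 2 + c ^ 2 + 2 * (a * b * -cos β + b * c * cos β + c * a * -1) := by
          linear_combination b ^ 2 * sin_sq β
      _ ≤ cosForm α β γ a b c := by
          rw [cosForm]
          gcongr
          exact neg_one_le_cos γ

theorem add_le_pi_of_cosForm_pi_nonneg (hβ : β ∈ Set.Icc 0 π) (hγ : γ ∈ Set.Icc 0 π)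
    (h : ∀ c, 0 ≤ c → 0 ≤ cosForm π β γ 1 1 c) : β + γ ≤ π := by
  rw [add_le_pi_iff_cos_add_cos_nonneg hβ hγ]
  by_contra! hneg
  have := h (-(cos β + cos γ)) (by linarith)
  rw [cosForm, cos_pi] at this
  nlinarith

/-- The weights are the coefficients of the linear relation between three unit vectors in the plane
whose consecutive angles are `α` and `β`. -/
theorem cosForm_add_sin (α β : ℝ) :
    cosForm α β (α + β) (sin β) (-sin (α + β)) (sin α) = 0 := by
  rw [cosForm_add_eq_sq_add_sq, sin_add]
  ring

theorem add_le_two_pi_of_cosForm_nonneg (hα : α ∈ Set.Icc 0 π) (hβ : β ∈ Set.Icc 0 π)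
    (hγ : γ ∈ Set.Icc 0 π)
    (h : ∀ a b c : ℝ, 0 ≤ a → 0 ≤ b → 0 ≤ c → 0 ≤ cosForm α β γ a b c) :
    α + β + γ ≤ 2 * π := by
  by_contra! hlt
  rcases eq_or_lt_of_le hα.2 with rfl | hα'
  · have := add_le_pi_of_cosForm_pi_nonneg hβ hγ fun c hc => h 1 1 c zero_le_one zero_le_one hc
    linarith
  rcases eq_or_lt_of_le hβ.2 with rfl | hβ'
  · have := add_le_pi_of_cosForm_pi_nonneg hγ hα fun c hc => by
      rw [← cosForm_rotate]
      exact h c 1 1 hc zero_le_one zero_le_one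
    linarith
  have hsinα : 0 < sin α := sin_pos_of_pos_of_lt_pi (by linarith [hγ.2]) hα'
  have hsinβ : 0 < sin β := sin_pos_of_pos_of_lt_pi (by linarith [hγ.2]) hβ'
  have hsin : 0 ≤ -sin (α + β) := by
    rw [← sin_sub_pi]
    exact sin_nonneg_of_nonneg_of_le_pi (by linarith [hγ.2]) (by linarith)
  have hcos : cos γ < cos (α + β) := by
    rw [← cos_two_pi_sub (α + β)]
    exact cos_lt_cos_of_nonneg_of_le_pi (by linarith) hγ.2 (by linarith)
  have hneg : cosForm α β γ (sin β) (-sin (α + β)) (sin α) < 0 := by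
    rw [← cosForm_add_sin α β]
    simp only [cosForm]
    gcongr
  exact hneg.not_ge (h _ _ _ hsinβ.le hsin hsinα.le)

end CosForm

section ModelAngle

open Real

variable {X : Type*} [MetricSpace X] {p x y z : X}

theorem modelAngle_mem_Icc (p x y : X) : modelAngle p x y ∈ Set.Icc 0 π :=
  ⟨arccos_nonneg _, arccos_le_pi _⟩

/-- Junk value: the law of cosines divides by `dist p p = 0`. -/
theorem modelAngle_self_left (p y : X) : modelAngle p p y = π / 2 := by
  simp [modelAngle]

theorem modelAngle_self_right (p x : X) : modelAngle p x p = π / 2 := by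
  simp [modelAngle]

theorem dist_mul_dist_mul_cos_modelAngle (p x y : X) :
    dist p x * dist p y * cos (modelAngle p x y) = modelInner p x y := by
  rcases eq_or_ne p x with rfl | hx
  · simp [modelInner]
  rcases eq_or_ne p y with rfl | hy
  · simp [modelInner, dist_comm]
  have hpx : 0 < dist p x := dist_pos.2 hx
  have hpy : 0 < dist p y := dist_pos.2 hy
  have hxy := dist_triangle_left x y p
  have hsub : |dist p x - dist p y| ≤ dist x y := by
    simpa only [dist_comm] using abs_dist_sub_le x y p
  rw [modelAngle, cos_arccos, modelInner]
  · field_simp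
  · rw [le_div_iff₀ (by positivity)]
    linarith [pow_le_pow_left₀ dist_nonneg hxy 2]
  · rw [div_le_one (by positivity)]
    linarith [sq_le_sq' (abs_le.1 hsub).1 (abs_le.1 hsub).2]

theorem gramForm_eq_cosForm_modelAngle (p x y z : X) (r s t : ℝ) :
    gramForm p x y z r s t =
      cosForm (modelAngle p x y) (modelAngle p y z) (modelAngle p z x)
        (r * dist p x) (s * dist p y) (t * dist p z) := by
  simp only [gramForm, cosForm, ← dist_mul_dist_mul_cos_modelAngle]
  ring

theorem modelAngle_add_le_two_pi_of_eq (h : x = p ∨ y = p ∨ z = p) :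
    modelAngle p x y + modelAngle p y z + modelAngle p z x ≤ 2 * π := by
  have hxy := (modelAngle_mem_Icc p x y).2
  have hyz := (modelAngle_mem_Icc p y z).2
  have hzx := (modelAngle_mem_Icc p z x).2
  rcases h with rfl | rfl | rfl <;> simp only [modelAngle_self_left, modelAngle_self_right] <;>
    linarith

theorem gramForm_nonneg_of_modelAngle_add_le_two_pi
    (h : modelAngle p x y + modelAngle p y z + modelAngle p z x ≤ 2 * π) {r s t : ℝ}
    (hr : 0 ≤ r) (hs : 0 ≤ s) (ht : 0 ≤ t) : 0 ≤ gramForm p x y z r s t := by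
  rw [gramForm_eq_cosForm_modelAngle]
  exact cosForm_nonneg_of_add_le_two_pi (modelAngle_mem_Icc p x y) (modelAngle_mem_Icc p y z)
    (modelAngle_mem_Icc p z x) h (by positivity) (by positivity) (by positivity)

theorem modelAngle_add_le_two_pi_of_gramForm_nonneg (hx : x ≠ p) (hy : y ≠ p) (hz : z ≠ p)
    (h : ∀ r s t : ℝ, 0 ≤ r → 0 ≤ s → 0 ≤ t → 0 ≤ gramForm p x y z r s t) :
    modelAngle p x y + modelAngle p y z + modelAngle p z x ≤ 2 * π := by
  refine add_le_two_pi_of_cosForm_nonneg (modelAngle_mem_Icc p x y) (modelAngle_mem_Icc p y z)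
    (modelAngle_mem_Icc p z x) fun a b c ha hb hc => ?_
  have := h (a / dist p x) (b / dist p y) (c / dist p z) (by positivity) (by positivity)
    (by positivity)
  rwa [gramForm_eq_cosForm_modelAngle, div_mul_cancel₀ a (dist_ne_zero.2 hx.symm),
    div_mul_cancel₀ b (dist_ne_zero.2 hy.symm), div_mul_cancel₀ c (dist_ne_zero.2 hz.symm)] at this

end ModelAngle

theorem mainTheorem1_general {X : Type*} [MetricSpace X] (hX : HasApproxIntermediatePoints X) :
    (∀ p x y z : X, x ≠ p → y ≠ p → z ≠ p →
      modelAngle p x y + modelAngle p y z + modelAngle p z x ≤ 2 * Real.pi) ↔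
      ∀ p x y z : X,
        dist p x ^ 2 + dist p y ^ 2 + dist p z ^ 2 ≥
          (1 / 3) * (dist x y ^ 2 + dist y z ^ 2 + dist z x ^ 2) := by
  constructor
  · intro hangle
    refine barycentricInequality_iff_gramForm_one_nonneg.2 fun p x y z => ?_
    refine gramForm_nonneg_of_modelAngle_add_le_two_pi ?_ zero_le_one zero_le_one zero_le_one
    by_cases hp : x = p ∨ y = p ∨ z = p
    · exact modelAngle_add_le_two_pi_of_eq hp
    · push Not at hp
      exact hangle p x y z hp.1 hp.2.1 hp.2.2
  · intro hbary p x y z hx hy hz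
    have hbary : BarycentricInequality X := hbary
    exact modelAngle_add_le_two_pi_of_gramForm_nonneg hx hy hz fun r s t hr hs ht =>
      hbary.gramForm_nonneg hX p x y z hr hs ht

theorem mainTheorem1 {X : Type*} [MetricSpace X] [CompleteSpace X] (hX : IsIntrinsicMetric X) :
    IsAlexandrovNonneg X ↔
      ∀ p x y z : X,
        dist p x ^ 2 + dist p y ^ 2 + dist p z ^ 2 ≥
          (1 / 3) * (dist x y ^ 2 + dist y z ^ 2 + dist z x ^ 2) := by
  rw [← mainTheorem1_general hX.hasApproxIntermediatePoints]
  exact ⟨fun h => h.comparison, fun h => ⟨inferInstance, hX, h⟩⟩
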